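/- Let $n\ge 1$, $\eta\in[0,1]$, and for $b\in\mathbb Z^n$, $t\in S^{n-1}\subset\mathbb R^n$ let $\psi(b,t)=|b|^2+\eta\,(b\cdot t)^2$. Let $\tilde\psi(b,T)=|T|\,\psi(b,T/|T|)$ for $T\in\mathbb R^n\setminus\{0\}$, $\tilde\psi(b,0)=0$, be its positively one-homogeneous extension in the second argument. Let $B_{1/2}\subset\mathbb R^n$ be the open ball of radius $1/2$ centred at $0$, and let $\mathcal M$ be the set of $\mathbb R^{n\times n}$-valued measures of the form $\mu=\theta\otimes\tau\,\mathcal H^1\llcorner\gamma$, where $\gamma\subset B_{1/2}$ is a $1$-rectifiable set, $\tau:\gamma\to S^{n-1}$ is its tangent vector and $\theta:\gamma\to\mathbb Z^n$ is $\mathcal H^1$-integrable, that are divergence free in $B_{1/2}$, i.e. $\int_\gamma \theta_i\, D\varphi\cdot\tau\,d\mathcal H^1=0$ for all $\varphi\in C_c^\infty(B_{1/2})$ and all $i$. For $b\in\mathbb Z^n$ and $t\in S^{n-1}$ let $$\bar\psi(b,t)=\inf\Big\{\int_\gamma\psi(\theta,\tau)\,d\mathcal H^1:\ \mu=\theta\otimes\tau\,\mathcal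 H^1\llcorner\gamma\in\mathcal M,\ \ \mu=b\otimes t\,\mathcal H^1\llcorner(\mathbb R t\cap B_{1/2})\ \text{on } B_{1/2}\setminus B' \text{ for some ball } B'\subset\subset B_{1/2}\Big\}$$ be the $\mathcal H^1$-elliptic envelope of $\psi$. If $n\le 9$, then for all $b\in\mathbb Z^n$ and $t\in S^{n-1}$ $$\bar\psi(b,t)\ \ge\ \min\Big\{\sum_{\alpha\in A}\tilde\psi(\alpha,T_\alpha):\ T_\alpha\in\mathbb R^n\ (\alpha\in A),\ \ \sum_{\alpha\in A}\alpha\otimes T_\alpha=b\otimes t\Big\}$$ with $A=\{-1,0,1\}^n$; in particular, the minimum is attained. If $n\ge 10$, the same holds with $A=[-2n,2n]^n\cap\mathbb Z^n$. -/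

import Mathlib

open MeasureTheory Set
open scoped ENNReal ContDiff

noncomputable section

namespace DislocationRelaxation

/-- `ℝⁿ` with its Euclidean norm. -/
abbrev E (n : ℕ) : Type := EuclideanSpace ℝ (Fin n)

/-- The lattice vector `b ∈ ℤⁿ` seen as an element of `ℝⁿ`. -/
def latticeVec {n : ℕ} (b : Fin n → ℤ) : E n := WithLp.toLp 2 fun i => (b i : ℝ)

/-- `γ ⊂ ℝⁿ` is `1`-rectifiable: it is `ℋ¹`-measurable and, up to an `ℋ¹`-null set, covered by
countably many Lipschitz curves. -/
def IsRectifiable {n : ℕ} (γ : Set (E n)) : Prop :=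
  NullMeasurableSet γ (μH[1]) ∧
    ∃ f : ℕ → ℝ → E n, (∀ k, ∃ K, LipschitzWith K (f k)) ∧ μH[1] (γ \ ⋃ k, range (f k)) = 0

/-- `τ` is a (unit, measurable) tangent vector field of the rectifiable set `γ`: countably many
`C¹` curves cover `ℋ¹`-almost all of `γ`, and at `ℋ¹`-almost every point of `γ` the vector `τ x`
spans the tangent line of one of these curves. (Tangents of two `C¹` curves agree `ℋ¹`-almost
everywhere on their intersection, so this determines `τ` up to sign `ℋ¹`-almost everywhere on `γ`
and does not depend on the curves. The orientation is free.) -/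
def IsTangentField {n : ℕ} (γ : Set (E n)) (τ : E n → E n) : Prop :=
  AEStronglyMeasurable τ ((μH[1]).restrict γ) ∧
  (∀ᵐ x ∂(μH[1]).restrict γ, ‖τ x‖ = 1) ∧
    ∃ f : ℕ → ℝ → E n, (∀ k, ContDiff ℝ 1 (f k)) ∧
      ∀ᵐ x ∂(μH[1]).restrict γ,
        ∃ (k : ℕ) (s c : ℝ), f k s = x ∧ c ≠ 0 ∧ deriv (f k) s = c • τ x

/-- The matrix-valued measure `θ ⊗ τ ℋ¹⌞γ`; the matrix entries are `(i, j) ↦ θᵢ τⱼ`. -/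
def lineMeasure {m n : ℕ} (γ : Set (E n)) (θ : E n → Fin m → ℤ) (τ : E n → E n) :
    VectorMeasure (E n) (Fin m → Fin n → ℝ) :=
  ((μH[1]).restrict γ).withDensityᵥ fun x i j => (θ x i : ℝ) * τ x j

/-- `θ ⊗ τ ℋ¹⌞γ` is a divergence-free measure on `Ω`, with `γ ⊂ Ω` a `1`-rectifiable set, `τ` its
tangent vector and `θ` an `ℋ¹`-integrable `ℤᵐ`-valued multiplicity. The divergence is taken
row by row, in the sense of distributions on `Ω`. -/
structure IsDivFreeLine {m n : ℕ} (Ω : Set (E n)) (γ : Set (E n)) (θ : E n → Fin m → ℤ)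
    (τ : E n → E n) : Prop where
  subset : γ ⊆ Ω
  rectifiable : IsRectifiable γ
  tangent : IsTangentField γ τ
  integrable : Integrable (fun x => latticeVec (θ x)) ((μH[1]).restrict γ)
  divFree : ∀ φ : E n → ℝ, ContDiff ℝ ∞ φ → HasCompactSupport φ → tsupport φ ⊆ Ω →
    ∀ i : Fin m, ∫ x in γ, (θ x i : ℝ) * fderiv ℝ φ x (τ x) ∂(μH[1]) = 0

/-- The ball `B_{1/2}`. -/
abbrev halfBall (n : ℕ) : Set (E n) := Metric.ball 0 (1 / 2)

/-- The measure `θ ⊗ τ ℋ¹⌞γ` has the boundary values of the straight line `b ⊗ t ℋ¹⌞(ℝt)` on the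
ball `B_{1/2}`: the two measures agree outside a smaller ball. -/
def HasLineBoundaryValues {m n : ℕ} (b : Fin m → ℤ) (t : E n) (γ : Set (E n))
    (θ : E n → Fin m → ℤ) (τ : E n → E n) : Prop :=
  ∃ r : ℝ, 0 < r ∧ r < 1 / 2 ∧
    ∀ A : Set (E n), MeasurableSet A → A ⊆ halfBall n \ Metric.closedBall 0 r →
      lineMeasure γ θ τ A =
        lineMeasure ((Submodule.span ℝ {t} : Set (E n)) ∩ halfBall n) (fun _ => b) (fun _ => t) A

/-- The `ℋ¹`-elliptic envelope of a nonnegative integrand `ψ`, defined by the cell problem on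
`B_{1/2}` (an infimum in `[0, ∞]`). Only the values of `ψ` at unit vectors matter. -/
def ellipticEnvelope {m n : ℕ} (ψ : (Fin m → ℤ) → E n → ℝ) (b : Fin m → ℤ) (t : E n) : ℝ≥0∞ :=
  sInf {e | ∃ (γ : Set (E n)) (θ : E n → Fin m → ℤ) (τ : E n → E n),
    IsDivFreeLine (halfBall n) γ θ τ ∧ HasLineBoundaryValues b t γ θ τ ∧
      e = ∫⁻ x in γ, ENNReal.ofReal (ψ (θ x) (τ x)) ∂(μH[1])}

/-- The energy density `ψ(b,t) = |b|² + η (b·t)²`. -/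
def cubicDensity {n : ℕ} (η : ℝ) (b : Fin n → ℤ) (t : E n) : ℝ :=
  ‖latticeVec b‖ ^ 2 + η * (inner ℝ (latticeVec b) t) ^ 2

/-- The positively one-homogeneous extension `(b,t) ↦ |t| ψ(b, t/|t|)`, with value `0` at
`t = 0`. -/
def homExt {m n : ℕ} (ψ : (Fin m → ℤ) → E n → ℝ) (b : Fin m → ℤ) (t : E n) : ℝ :=
  ‖t‖ * ψ b (‖t‖⁻¹ • t)

/-- The values `∑_{α ∈ A} ψ̃(α, T_α)` over all families `T` with
`∑_{α ∈ A} α ⊗ T_α = b ⊗ t`. -/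
def decompositionValues {m n : ℕ} (ψ : (Fin m → ℤ) → E n → ℝ) (A : Finset (Fin m → ℤ))
    (b : Fin m → ℤ) (t : E n) : Set ℝ :=
  {e | ∃ T : (Fin m → ℤ) → E n,
    (∑ α ∈ A, Matrix.vecMulVec (fun i => (α i : ℝ)) (fun j => T α j)) =
        Matrix.vecMulVec (fun i => (b i : ℝ)) (fun j => t j) ∧
      e = ∑ α ∈ A, homExt ψ α (T α)}

end DislocationRelaxation

end

namespace DislocationRelaxation

variable {m n : ℕ}

/-! ### Splitting lattice vectors -/

theorem latticeVec_add (b c : Fin n → ℤ) :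
    latticeVec (b + c) = latticeVec b + latticeVec c := by
  ext i; simp [latticeVec]

theorem latticeVec_zero : latticeVec (0 : Fin n → ℤ) = 0 := by
  ext i; simp [latticeVec]

theorem inner_latticeVec (b c : Fin n → ℤ) :
    inner ℝ (latticeVec b) (latticeVec c) = ((∑ i, b i * c i : ℤ) : ℝ) := by
  simp [latticeVec, PiLp.inner_apply, mul_comm]

theorem norm_sq_latticeVec (b : Fin n → ℤ) :
    ‖latticeVec b‖ ^ 2 = ((∑ i, b i * b i : ℤ) : ℝ) := by
  rw [← inner_latticeVec, real_inner_self_eq_norm_sq]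

theorem one_le_norm_sq_latticeVec {b : Fin n → ℤ} (hb : b ≠ 0) : 1 ≤ ‖latticeVec b‖ ^ 2 := by
  obtain ⟨i, hi⟩ := Function.ne_iff.mp hb
  rw [norm_sq_latticeVec]
  have h1 : 1 ≤ b i * b i := by
    have : 0 < b i * b i := mul_self_pos.mpr hi
    omega
  have h2 : b i * b i ≤ ∑ i, b i * b i :=
    Finset.single_le_sum (f := fun i => b i * b i) (fun j _ => mul_self_nonneg (b j))
      (Finset.mem_univ i)
  exact_mod_cast h1.trans h2

theorem cubicDensity_nonneg {η : ℝ} (hη : 0 ≤ η) (b : Fin n → ℤ) (t : E n) :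
    0 ≤ cubicDensity η b t := by
  unfold cubicDensity; positivity

theorem cubicDensity_zero (η : ℝ) (t : E n) : cubicDensity η (0 : Fin n → ℤ) t = 0 := by
  simp [cubicDensity, latticeVec_zero]

theorem one_le_cubicDensity {η : ℝ} (hη : 0 ≤ η) {b : Fin n → ℤ} (hb : b ≠ 0) (t : E n) :
    1 ≤ cubicDensity η b t :=
  (one_le_norm_sq_latticeVec hb).trans (le_add_of_nonneg_right (by positivity))

/-- The product of two components in a common unit direction is at least half the difference
between the inner product and the product of the norms. -/
theorem inner_sub_norm_mul_norm_le {F : Type*} [NormedAddCommGroup F] [InnerProductSpace ℝ F]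
    (u v t : F) (ht : ‖t‖ = 1) :
    inner ℝ u v - ‖u‖ * ‖v‖ ≤ 2 * (inner ℝ u t * inner ℝ v t) := by
  rcases eq_or_ne u 0 with rfl | hu
  · simp
  rcases eq_or_ne v 0 with rfl | hv
  · simp
  have hu' : 0 < ‖u‖ := norm_pos_iff.mpr hu
  have hv' : 0 < ‖v‖ := norm_pos_iff.mpr hv
  set p := inner ℝ u t
  set q := inner ℝ v t
  -- Cauchy–Schwarz for ‖v‖u − ‖u‖v against t. The claim then follows from 4‖u‖‖v‖pq = (‖v‖p +
  -- ‖u‖q)² − (‖v‖p − ‖u‖q)², dropping the first square.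
  have h1 : (‖v‖ * p - ‖u‖ * q) ^ 2 ≤ ‖(‖v‖ • u - ‖u‖ • v : F)‖ ^ 2 := by
    have h := abs_real_inner_le_norm (‖v‖ • u - ‖u‖ • v) t
    rw [ht, mul_one, inner_sub_left, real_inner_smul_left, real_inner_smul_left] at h
    exact sq_le_sq' (by linarith [neg_abs_le (‖v‖ * p - ‖u‖ * q)]) ((le_abs_self _).trans h)
  have h2 : ‖(‖v‖ • u - ‖u‖ • v : F)‖ ^ 2
      = 2 * (‖u‖ * ‖v‖) * (‖u‖ * ‖v‖ - inner ℝ u v) := by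
    rw [norm_sub_sq_real, real_inner_smul_left, real_inner_smul_right, norm_smul, norm_smul,
      norm_norm, norm_norm]
    ring
  have h3 : 0 ≤ (‖v‖ * p + ‖u‖ * q) ^ 2 := sq_nonneg _
  have hpos : 0 < 2 * (‖u‖ * ‖v‖) := by positivity
  refine le_of_mul_le_mul_left ?_ hpos
  rw [h2] at h1
  linarith

/-- Splitting a lattice vector into two parts at an angle with cosine at least `1/3` does not
increase the energy density. -/
theorem cubicDensity_add_le {η : ℝ} (hη : η ∈ Icc (0 : ℝ) 1) {b c : Fin n → ℤ} {t : E n}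
    (ht : ‖t‖ = 1)
    (h : ‖latticeVec b‖ * ‖latticeVec c‖ ≤ 3 * inner ℝ (latticeVec b) (latticeVec c)) :
    cubicDensity η b t + cubicDensity η c t ≤ cubicDensity η (b + c) t := by
  unfold cubicDensity
  rw [latticeVec_add, norm_add_sq_real, inner_add_left]
  have h1 := inner_sub_norm_mul_norm_le (latticeVec b) (latticeVec c) t ht
  have h0 : 0 ≤ ‖latticeVec b‖ * ‖latticeVec c‖ := by positivity
  set x := inner ℝ (latticeVec b) t * inner ℝ (latticeVec c) t with hx
  -- Half the cross term. If x < 0, the worst case is η = 1, where x ≥ (b·c − |b||c|)/2 ≥ −b·c; this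
  -- is where the cosine bound 1/3 enters.
  have h2 : 0 ≤ inner ℝ (latticeVec b) (latticeVec c) + η * x := by
    rcases le_total 0 x with hx0 | hx0
    · have := mul_nonneg hη.1 hx0
      linarith
    · nlinarith [hη.2]
  linarith [hx]

/-- The `ℓ¹` norm of a lattice vector. -/
def latticeSize (b : Fin n → ℤ) : ℕ := ∑ i, (b i).natAbs

/-- If every lattice vector outside `A` splits into two smaller ones at a small angle, then every
lattice vector decomposes into vectors of `A` without increasing the energy density. -/
theorem exists_decomposition (A : Finset (Fin n → ℤ))
    (hA : ∀ a ∉ A, ∃ b c : Fin n → ℤ, b + c = a ∧ latticeSize b < latticeSize a ∧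
      latticeSize c < latticeSize a ∧
      ‖latticeVec b‖ * ‖latticeVec c‖ ≤ 3 * inner ℝ (latticeVec b) (latticeVec c))
    (a : Fin n → ℤ) :
    ∃ c : (Fin n → ℤ) → ℕ, c 0 = 0 ∧ (∀ i, ∑ b ∈ A, (c b : ℝ) * (b i : ℝ) = a i) ∧
      ∀ η ∈ Icc (0 : ℝ) 1, ∀ t : E n, ‖t‖ = 1 →
        ∑ b ∈ A, (c b : ℝ) * cubicDensity η b t ≤ cubicDensity η a t := by
  induction hs : latticeSize a using Nat.strong_induction_on generalizing a with
  | _ s ih =>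
    subst hs
    by_cases ha : a ∈ A
    -- The zero vector gets the empty decomposition: its density vanishes, so the energy could not
    -- control a coefficient in front of it.
    · by_cases ha0 : a = 0
      · subst ha0
        exact ⟨0, rfl, by simp, by simp [cubicDensity_zero]⟩
      · exact ⟨Pi.single a 1, by simp [Ne.symm ha0],
          by simp [Pi.single_apply, ha], by simp [Pi.single_apply, ha]⟩
    · obtain ⟨b, c, rfl, hb, hc, hbc⟩ := hA a ha
      obtain ⟨p, hp0, hp, hp'⟩ := ih _ hb b rfl
      obtain ⟨q, hq0, hq, hq'⟩ := ih _ hc c rfl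
      refine ⟨p + q, by simp [hp0, hq0], fun i => ?_, fun η hη t ht => ?_⟩
      · simp [add_mul, Finset.sum_add_distrib, hp, hq]
      · simp only [Pi.add_apply, Nat.cast_add, add_mul, Finset.sum_add_distrib]
        exact (add_le_add (hp' η hη t ht) (hq' η hη t ht)).trans (cubicDensity_add_le hη ht hbc)

/-- Peel off the vector b of signs of a. The remainder c has compatible signs, so b·c = |c|₁ ≥ |c|,
while |b| ≤ √n ≤ 3; thus 9 = 3² is the dimension threshold. Sizes drop strictly at a coordinate with
|a_k| ≥ 2. -/
theorem exists_split_sign (hn : n ≤ 9) (a : Fin n → ℤ)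
    (ha : a ∉ Fintype.piFinset fun _ : Fin n => ({-1, 0, 1} : Finset ℤ)) :
    ∃ b c : Fin n → ℤ, b + c = a ∧ latticeSize b < latticeSize a ∧
      latticeSize c < latticeSize a ∧
      ‖latticeVec b‖ * ‖latticeVec c‖ ≤ 3 * inner ℝ (latticeVec b) (latticeVec c) := by
  simp only [Fintype.mem_piFinset, not_forall] at ha
  obtain ⟨k, hk⟩ := ha
  have hk : 2 ≤ (a k).natAbs := by
    simp only [Finset.mem_insert, Finset.mem_singleton] at hk
    omega
  have key : ∀ z : ℤ, z.sign.natAbs ≤ z.natAbs ∧ (z - z.sign).natAbs ≤ z.natAbs ∧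
      z.sign.natAbs ≤ 1 ∧ (2 ≤ z.natAbs → (z - z.sign).natAbs < z.natAbs) ∧
      z.sign * z.sign ≤ 1 ∧ z.sign * (z - z.sign) = |z - z.sign| := by
    intro z
    rcases lt_trichotomy z 0 with h | rfl | h
    · rw [Int.sign_eq_neg_one_of_neg h, abs_of_nonpos (by omega)]
      omega
    · simp
    · rw [Int.sign_eq_one_of_pos h, abs_of_nonneg (by omega)]
      omega
  set b : Fin n → ℤ := fun i => (a i).sign with hb
  set c : Fin n → ℤ := fun i => a i - (a i).sign with hc
  refine ⟨b, c, by ext i; simp [hb, hc], ?_, ?_, ?_⟩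
  · exact Finset.sum_lt_sum (fun i _ => (key (a i)).1)
      ⟨k, Finset.mem_univ k, ((key (a k)).2.2.1).trans_lt hk⟩
  · exact Finset.sum_lt_sum (fun i _ => (key (a i)).2.1)
      ⟨k, Finset.mem_univ k, (key (a k)).2.2.2.1 hk⟩
  · have h1 : ‖latticeVec b‖ ≤ 3 := by
      have : (∑ i, b i * b i) ≤ 9 := by
        calc (∑ i, b i * b i) ≤ ∑ _i : Fin n, (1 : ℤ) :=
              Finset.sum_le_sum fun i _ => (key (a i)).2.2.2.2.1
          _ ≤ 9 := by simpa using hn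
      have h : ‖latticeVec b‖ ^ 2 ≤ 9 := by
        rw [norm_sq_latticeVec]; exact_mod_cast this
      nlinarith [norm_nonneg (latticeVec b)]
    have h2 : inner ℝ (latticeVec b) (latticeVec c) = ((∑ i, |c i| : ℤ) : ℝ) := by
      rw [inner_latticeVec]
      congr 1
      exact Finset.sum_congr rfl fun i _ => (key (a i)).2.2.2.2.2
    have h3 : ‖latticeVec c‖ ≤ ((∑ i, |c i| : ℤ) : ℝ) := by
      have h0 : (0 : ℤ) ≤ ∑ i, |c i| := Finset.sum_nonneg fun i _ => abs_nonneg _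
      refine le_of_sq_le_sq ?_ (by exact_mod_cast h0)
      rw [norm_sq_latticeVec]
      have : ∑ i, |c i| * |c i| ≤ (∑ i, |c i|) ^ 2 :=
        (Finset.sum_le_sum fun i hi => mul_le_mul_of_nonneg_left
          (Finset.single_le_sum (f := fun j => |c j|) (fun j _ => abs_nonneg (c j)) hi)
          (abs_nonneg (c i))).trans_eq (by rw [← Finset.sum_mul, sq])
      have h4 : ∑ i, c i * c i = ∑ i, |c i| * |c i| :=
        Finset.sum_congr rfl fun i _ => by rw [abs_mul_abs_self]
      rw [h4]
      exact_mod_cast this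
    rw [h2]
    exact mul_le_mul h1 h3 (norm_nonneg _) (by norm_num)

/-- Halve a, rounding down, so that the two parts differ by 0 or 1 in each coordinate. As 2|b||c| ≤
|b|² + |c|², it suffices that |b|² + |c|² ≤ 6 b·c. Rounding costs at most 1 per coordinate, and the
coordinate with |a_k| > 2n gains at least n, which pays for the n − 1 others. -/
theorem exists_split_half (hn : 2 ≤ n) (a : Fin n → ℤ)
    (ha : a ∉ Fintype.piFinset fun _ : Fin n => Finset.Icc (-(2 * n : ℤ)) (2 * n)) :
    ∃ b c : Fin n → ℤ, b + c = a ∧ latticeSize b < latticeSize a ∧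
      latticeSize c < latticeSize a ∧
      ‖latticeVec b‖ * ‖latticeVec c‖ ≤ 3 * inner ℝ (latticeVec b) (latticeVec c) := by
  simp only [Fintype.mem_piFinset, not_forall, Finset.mem_Icc] at ha
  obtain ⟨k, hk⟩ := ha
  set b : Fin n → ℤ := fun i => a i / 2 with hb
  set c : Fin n → ℤ := fun i => a i - a i / 2 with hc
  refine ⟨b, c, by ext i; simp [hb, hc], ?_, ?_, ?_⟩
  · exact Finset.sum_lt_sum (fun i _ => by simp only [hb]; omega)
      ⟨k, Finset.mem_univ k, by simp only [hb]; omega⟩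
  · exact Finset.sum_lt_sum (fun i _ => by simp only [hc]; omega)
      ⟨k, Finset.mem_univ k, by simp only [hc]; omega⟩
  -- With c i = b i + d, the expression is 4 b² for d = 0 and 4 b(b+1) − 1 for d = 1; the product
  -- b(b+1) is nonnegative for integers.
  · have hlow : ∀ i, -1 ≤ 6 * (b i * c i) - b i * b i - c i * c i := by
      intro i
      obtain ⟨d, hd, hd0, hd1⟩ : ∃ d, c i = b i + d ∧ 0 ≤ d ∧ d ≤ 1 :=
        ⟨c i - b i, by ring, by simp only [hb, hc]; omega, by simp only [hb, hc]; omega⟩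
      rw [hd]
      obtain rfl | rfl : d = 0 ∨ d = 1 := by omega
      · nlinarith [sq_nonneg (b i)]
      · rcases le_or_gt 0 (b i) with h | h
        · nlinarith
        · nlinarith [mul_nonneg (show 0 ≤ -b i by omega) (show 0 ≤ -(b i + 1) by omega)]
    have hbig : (n : ℤ) ≤ 6 * (b k * c k) - b k * b k - c k * c k := by
      obtain ⟨d, hd, hd0, hd1⟩ : ∃ d, c k = b k + d ∧ 0 ≤ d ∧ d ≤ 1 :=
        ⟨c k - b k, by ring, by simp only [hb, hc]; omega, by simp only [hb, hc]; omega⟩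
      have h1 : (n : ℤ) ≤ b k ∨ b k ≤ -n - 1 := by simp only [hb]; omega
      have h2 : (2 : ℤ) ≤ n := by exact_mod_cast hn
      have h3 : (n : ℤ) * (n - 1) ≤ b k * (b k + 1) := by
        rcases h1 with h | h <;> nlinarith
      have h4 : (n : ℤ) * (n - 1) ≤ b k * b k := by
        rcases h1 with h | h <;> nlinarith
      rw [hd]
      obtain rfl | rfl : d = 0 ∨ d = 1 := by omega
      · nlinarith
      · nlinarith
    have hsum : 0 ≤ ∑ i, (6 * (b i * c i) - b i * b i - c i * c i) := by
      rw [← Finset.add_sum_erase _ _ (Finset.mem_univ k)]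
      have h : ∑ i ∈ Finset.univ.erase k, (-1 : ℤ) ≤
          ∑ i ∈ Finset.univ.erase k, (6 * (b i * c i) - b i * b i - c i * c i) :=
        Finset.sum_le_sum fun i _ => hlow i
      rw [Finset.sum_const, Finset.card_erase_of_mem (Finset.mem_univ k), Finset.card_univ,
        Fintype.card_fin, nsmul_eq_mul, Nat.cast_sub (by omega)] at h
      push_cast at h
      linarith
    rw [Finset.sum_sub_distrib, Finset.sum_sub_distrib, ← Finset.mul_sum] at hsum
    have hsum' : (0 : ℝ) ≤ 6 * inner ℝ (latticeVec b) (latticeVec c) - ‖latticeVec b‖ ^ 2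
        - ‖latticeVec c‖ ^ 2 := by
      rw [inner_latticeVec, norm_sq_latticeVec, norm_sq_latticeVec]
      exact_mod_cast hsum
    nlinarith [sq_nonneg (‖latticeVec b‖ - ‖latticeVec c‖)]

/-! ### The one-homogeneous extension -/

theorem homExt_cubicDensity (η : ℝ) (b : Fin n → ℤ) (T : E n) :
    homExt (cubicDensity η) b T =
      ‖latticeVec b‖ ^ 2 * ‖T‖ + η * (inner ℝ (latticeVec b) T) ^ 2 / ‖T‖ := by
  unfold homExt cubicDensity
  rcases eq_or_ne T 0 with rfl | hT
  · simp
  · have : ‖T‖ ≠ 0 := norm_ne_zero_iff.mpr hT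
    rw [real_inner_smul_right]
    field_simp

theorem homExt_nonneg {η : ℝ} (hη : 0 ≤ η) (b : Fin n → ℤ) (T : E n) :
    0 ≤ homExt (cubicDensity η) b T :=
  mul_nonneg (norm_nonneg _) (cubicDensity_nonneg hη _ _)

theorem homExt_zero_left (η : ℝ) (T : E n) :
    homExt (cubicDensity η) (0 : Fin n → ℤ) T = 0 := by
  simp [homExt, cubicDensity_zero]

theorem norm_le_homExt {η : ℝ} (hη : 0 ≤ η) {b : Fin n → ℤ} (hb : b ≠ 0) (T : E n) :
    ‖T‖ ≤ homExt (cubicDensity η) b T :=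
  le_mul_of_one_le_right (norm_nonneg _) (one_le_cubicDensity hη hb _)

/-- Away from the origin the explicit quotient is continuous; at the origin the bound |b|²(1+η)‖T‖
squeezes it to 0. -/
theorem continuous_homExt {η : ℝ} (hη : 0 ≤ η) (b : Fin n → ℤ) :
    Continuous (homExt (cubicDensity η) b) := by
  have hfun : homExt (cubicDensity η) b = fun T : E n =>
      ‖latticeVec b‖ ^ 2 * ‖T‖ + η * (inner ℝ (latticeVec b) T) ^ 2 / ‖T‖ :=
    funext (homExt_cubicDensity η b)
  rw [continuous_iff_continuousAt]
  intro T
  rcases eq_or_ne T 0 with rfl | hT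
  · have h0 : homExt (cubicDensity η) b 0 = 0 := by simp [homExt]
    rw [ContinuousAt, h0]
    refine squeeze_zero (g := fun T : E n => ‖latticeVec b‖ ^ 2 * (1 + η) * ‖T‖)
      (fun T => homExt_nonneg hη b T) (fun T => ?_) ?_
    · have h1 : (inner ℝ (latticeVec b) (‖T‖⁻¹ • T)) ^ 2 ≤ ‖latticeVec b‖ ^ 2 := by
        have h2 : ‖(‖T‖⁻¹ • T : E n)‖ ≤ 1 := by
          rw [norm_smul, norm_inv, norm_norm]
          exact inv_mul_le_one
        have h3 := abs_real_inner_le_norm (latticeVec b) (‖T‖⁻¹ • T)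
        have h4 := h3.trans (mul_le_of_le_one_right (norm_nonneg _) h2)
        rw [← sq_abs]
        gcongr
      have h5 := mul_le_mul_of_nonneg_left h1 hη
      unfold homExt cubicDensity
      nlinarith [norm_nonneg T]
    · have : Continuous fun T : E n => ‖latticeVec b‖ ^ 2 * (1 + η) * ‖T‖ := by fun_prop
      simpa using this.tendsto 0
  · have : ‖T‖ ≠ 0 := norm_ne_zero_iff.mpr hT
    rw [hfun]
    fun_prop (disch := assumption)

/-- At every unit vector the density has a supporting linear functional, i.e. its one-homogeneous
extension is convex. -/
theorem exists_supporting_functional {η : ℝ} (hη : η ∈ Icc (0 : ℝ) 1) (b : Fin n → ℤ) {t : E n}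
    (ht : ‖t‖ = 1) :
    ∃ L : E n →L[ℝ] ℝ, L t = cubicDensity η b t ∧ ∀ s, ‖s‖ = 1 → L s ≤ cubicDensity η b s := by
  set a := inner ℝ (latticeVec b) t with ha
  -- This is the gradient at t of |b|²‖T‖ + η(b·T)²/‖T‖. The gap ψ(b,s) − L s equals (|b|² − ηa²)(1
  -- − t·s) + η(b·s − a)², and η ≤ 1 makes the first factor nonnegative.
  refine ⟨(‖latticeVec b‖ ^ 2 - η * a ^ 2) • innerSL ℝ t + (2 * η * a) • innerSL ℝ (latticeVec b),
    ?_, fun s hs => ?_⟩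
  · simp only [_root_.add_apply, _root_.smul_apply, innerSL_apply_apply,
      smul_eq_mul, real_inner_self_eq_norm_sq, ht, cubicDensity, ← ha]
    ring
  · simp only [_root_.add_apply, _root_.smul_apply, innerSL_apply_apply,
      smul_eq_mul, cubicDensity]
    have h1 : inner ℝ t s ≤ 1 := by simpa [ht, hs] using real_inner_le_norm t s
    have h2 : η * a ^ 2 ≤ ‖latticeVec b‖ ^ 2 := by
      have h3 : |a| ≤ ‖latticeVec b‖ := by
        simpa [ht] using abs_real_inner_le_norm (latticeVec b) t
      have h4 : a ^ 2 ≤ ‖latticeVec b‖ ^ 2 := by rw [← sq_abs]; gcongr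
      nlinarith [hη.1, hη.2, sq_nonneg a]
    nlinarith [mul_nonneg hη.1 (sq_nonneg (inner ℝ (latticeVec b) s - a)),
      mul_nonneg (sub_nonneg.mpr h2) (sub_nonneg.mpr h1)]

/-- Jensen's inequality for the one-homogeneous extension. -/
theorem homExt_integral_le {X : Type*} [MeasurableSpace X] {μ : Measure X} {η : ℝ}
    (hη : η ∈ Icc (0 : ℝ) 1) (b : Fin n → ℤ) {w : X → ℝ} {τ : X → E n}
    (hw : ∀ᵐ x ∂μ, 0 ≤ w x) (hτ : ∀ᵐ x ∂μ, ‖τ x‖ = 1)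
    (hint : Integrable (fun x => w x • τ x) μ)
    (hint' : Integrable (fun x => w x * cubicDensity η b (τ x)) μ) :
    homExt (cubicDensity η) b (∫ x, w x • τ x ∂μ) ≤
      ∫ x, w x * cubicDensity η b (τ x) ∂μ := by
  set T := ∫ x, w x • τ x ∂μ with hT
  rcases eq_or_ne T 0 with h0 | h0
  · rw [h0]
    simp only [homExt, norm_zero, zero_mul]
    exact integral_nonneg_of_ae (hw.mono fun x hx =>
      mul_nonneg hx (cubicDensity_nonneg hη.1 _ _))
  · have hT0 : ‖T‖ ≠ 0 := norm_ne_zero_iff.mpr h0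
    have hunit : ‖(‖T‖⁻¹ • T : E n)‖ = 1 := by
      rw [norm_smul, norm_inv, norm_norm, inv_mul_cancel₀ hT0]
    obtain ⟨L, hL, hL'⟩ := exists_supporting_functional hη b hunit
    have h1 : homExt (cubicDensity η) b T = L T := by
      rw [homExt, ← hL, map_smul, smul_eq_mul, mul_inv_cancel_left₀ hT0]
    rw [h1, hT, ← L.integral_comp_comm hint]
    refine integral_mono_ae (L.integrable_comp hint) hint' ?_
    filter_upwards [hw, hτ] with x hx hx'
    rw [map_smul, smul_eq_mul]
    exact mul_le_mul_of_nonneg_left (hL' _ hx') hx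

/-! ### The total mass of an admissible measure -/

theorem isometry_smul_unit {t : E n} (ht : ‖t‖ = 1) : Isometry fun s : ℝ => s • t :=
  Isometry.of_dist_eq fun a b => by
    rw [dist_eq_norm, ← sub_smul, norm_smul, ht, mul_one, dist_eq_norm]

theorem range_smul_eq_span (t : E n) :
    range (fun s : ℝ => s • t) = (Submodule.span ℝ {t} : Set (E n)) := by
  ext x
  simp [Submodule.mem_span_singleton]

theorem map_smul_volume {t : E n} (ht : ‖t‖ = 1) :
    Measure.map (fun s : ℝ => s • t) volume =
      (μH[1]).restrict (Submodule.span ℝ {t} : Set (E n)) := by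
  rw [← hausdorffMeasure_real, (isometry_smul_unit ht).map_hausdorffMeasure (Or.inl zero_le_one),
    range_smul_eq_span]

theorem measurableSet_span (t : E n) :
    MeasurableSet (Submodule.span ℝ {t} : Set (E n)) :=
  (Submodule.closed_of_finiteDimensional _).measurableSet

/-- Radius 1/2 makes the segment have length 1, so that the total mass of the line is b ⊗ t without
a factor. -/
theorem hausdorffMeasure_line_inter_halfBall {t : E n} (ht : ‖t‖ = 1) :
    μH[1] ((Submodule.span ℝ {t} : Set (E n)) ∩ halfBall n) = 1 := by
  have hball : MeasurableSet (halfBall n) := measurableSet_ball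
  rw [inter_comm, ← Measure.restrict_apply hball, ← map_smul_volume ht,
    Measure.map_apply (isometry_smul_unit ht).continuous.measurable hball]
  have : (fun s : ℝ => s • t) ⁻¹' halfBall n = Metric.ball 0 (1 / 2) := by
    ext s; simp [norm_smul, ht]
  rw [this, Real.volume_ball]
  norm_num

/-- A straight line is divergence free. -/
theorem setIntegral_span_fderiv {t : E n} (ht : ‖t‖ = 1) {φ : E n → ℝ} (hφ : ContDiff ℝ ∞ φ)
    (hc : HasCompactSupport φ) :
    ∫ x in (Submodule.span ℝ {t} : Set (E n)), fderiv ℝ φ x t ∂(μH[1]) = 0 := by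
  have hemb := (isometry_smul_unit ht).isClosedEmbedding
  rw [← map_smul_volume ht, hemb.measurableEmbedding.integral_map]
  have hder : Continuous fun x => fderiv ℝ φ x t :=
    (hφ.continuous_fderiv (by simp)).clm_apply continuous_const
  refine integral_eq_zero_of_hasDerivAt_of_integrable (f := fun s : ℝ => φ (s • t))
    (fun s => ?_) ?_ ?_
  · have h1 : HasFDerivAt φ (fderiv ℝ φ (s • t)) (s • t) :=
      (hφ.differentiable (by simp)).differentiableAt.hasFDerivAt
    have h2 : HasDerivAt (fun s : ℝ => s • t) t s := by
      simpa using (hasDerivAt_id s).smul_const t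
    exact h1.comp_hasDerivAt s h2
  · exact (hder.comp hemb.continuous).integrable_of_hasCompactSupport
      ((hc.fderiv_apply ℝ t).comp_isClosedEmbedding hemb)
  · exact (hφ.continuous.comp hemb.continuous).integrable_of_hasCompactSupport
      (hc.comp_isClosedEmbedding hemb)

/-- Testing the divergence with x_j reads off the j-th component of the mass. The cut-off happens
between radius r and 1/2, where the measure already agrees with the line. -/
theorem exists_cutoff_coordinate {r : ℝ} (hr : 0 < r) (hr' : r < 1 / 2) (j : Fin n) :
    ∃ φ : E n → ℝ, ContDiff ℝ ∞ φ ∧ HasCompactSupport φ ∧ tsupport φ ⊆ halfBall n ∧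
      ∀ x ∈ Metric.closedBall (0 : E n) r, ∀ v, fderiv ℝ φ x v = v j := by
  obtain ⟨p, hp, hp'⟩ := exists_between hr'
  obtain ⟨q, hq, hq'⟩ := exists_between hp'
  let χ : ContDiffBump (0 : E n) := ⟨p, q, hr.trans hp, hq⟩
  have hcs : HasCompactSupport fun x : E n => χ x * x j := χ.hasCompactSupport.mul_right
  refine ⟨fun x => χ x * x j, χ.contDiff.mul ?_, hcs, ?_, fun x hx v => ?_⟩
  · exact (EuclideanSpace.proj j : E n →L[ℝ] ℝ).contDiff
  · refine (tsupport_mul_subset_left (f := χ)).trans ?_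
    rw [χ.tsupport_eq]
    exact Metric.closedBall_subset_ball hq'
  · have hev : (fun x : E n => χ x * x j) =ᶠ[nhds x]
        (EuclideanSpace.proj j : E n →L[ℝ] ℝ) := by
      have hxp : x ∈ Metric.ball (0 : E n) p := Metric.closedBall_subset_ball hp hx
      filter_upwards [Metric.isOpen_ball.mem_nhds hxp] with y hy
      rw [χ.one_of_mem_closedBall (Metric.ball_subset_closedBall hy), one_mul]
      rfl
    rw [hev.fderiv_eq, ContinuousLinearMap.fderiv]
    rfl

theorem integrable_fderiv_apply {X : Type*} [NormedAddCommGroup X] [NormedSpace ℝ X]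
    [MeasurableSpace X] [BorelSpace X] [SecondCountableTopology X] {μ : Measure X} {φ : X → ℝ}
    (hφ : ContDiff ℝ ∞ φ) (hc : HasCompactSupport φ) {f : X → X} (hf : Integrable f μ) :
    Integrable (fun x => fderiv ℝ φ x (f x)) μ := by
  have hcont : Continuous (fderiv ℝ φ) := hφ.continuous_fderiv (by simp)
  obtain ⟨C, hC⟩ := (hc.fderiv ℝ).exists_bound_of_continuous hcont
  refine (hf.norm.const_mul C).mono' ?_ (Filter.Eventually.of_forall fun x => ?_)
  · have h : Continuous fun p : X × X => fderiv ℝ φ p.1 p.2 :=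
      (hcont.comp continuous_fst).clm_apply continuous_snd
    exact h.comp_aestronglyMeasurable
      (aestronglyMeasurable_id.prodMk hf.aestronglyMeasurable)
  · exact ((fderiv ℝ φ x).le_opNorm _).trans
      (mul_le_mul_of_nonneg_right (hC x) (norm_nonneg _))

theorem setIntegral_indicator_eq {X F : Type*} [MeasurableSpace X] [NormedAddCommGroup F]
    [NormedSpace ℝ F] {μ : Measure X} {γ A : Set X} (hγ : NullMeasurableSet γ μ)
    (hA : MeasurableSet A) (f : X → F) :
    ∫ x in A, γ.indicator f x ∂μ = ∫ x in A, f x ∂(μ.restrict γ) := by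
  rw [integral_indicator₀ (hγ.mono_ac Measure.restrict_le_self.absolutelyContinuous),
    Measure.restrict_comm hA]

theorem IsDivFreeLine.norm_tangent {Ω γ : Set (E n)} {θ : E n → Fin m → ℤ} {τ : E n → E n}
    (h : IsDivFreeLine Ω γ θ τ) : ∀ᵐ x ∂(μH[1]).restrict γ, ‖τ x‖ = 1 :=
  h.tangent.2.1

theorem IsDivFreeLine.integrable_coord {Ω γ : Set (E n)} {θ : E n → Fin m → ℤ}
    {τ : E n → E n} (h : IsDivFreeLine Ω γ θ τ) (i : Fin m) :
    Integrable (fun x => (θ x i : ℝ)) ((μH[1]).restrict γ) :=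
  (EuclideanSpace.proj i : E m →L[ℝ] ℝ).integrable_comp h.integrable

theorem IsDivFreeLine.integrable_smul {Ω γ : Set (E n)} {θ : E n → Fin m → ℤ}
    {τ : E n → E n} (h : IsDivFreeLine Ω γ θ τ) {w : E n → ℝ}
    (hw : Integrable w ((μH[1]).restrict γ)) :
    Integrable (fun x => w x • τ x) ((μH[1]).restrict γ) := by
  refine hw.norm.mono' (hw.aestronglyMeasurable.smul h.tangent.1) ?_
  filter_upwards [h.norm_tangent] with x hx
  rw [norm_smul, hx, mul_one]

/-- An admissible measure agrees with the straight line outside a smaller ball, in terms of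
densities with respect to `ℋ¹`. -/
theorem IsDivFreeLine.ae_eq_line {γ : Set (E n)} {θ : E n → Fin m → ℤ} {τ : E n → E n}
    (h : IsDivFreeLine (halfBall n) γ θ τ) {b : Fin m → ℤ} {t : E n} (ht : ‖t‖ = 1) {r : ℝ}
    (hr : ∀ A : Set (E n), MeasurableSet A → A ⊆ halfBall n \ Metric.closedBall 0 r →
      lineMeasure γ θ τ A =
        lineMeasure ((Submodule.span ℝ {t} : Set (E n)) ∩ halfBall n) (fun _ => b)
          (fun _ => t) A) (i : Fin m) :
    ∀ᵐ x ∂(μH[1] : Measure (E n)), x ∉ Metric.closedBall 0 r →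
      γ.indicator (fun x => (θ x i : ℝ) • τ x) x =
        ((Submodule.span ℝ {t} : Set (E n)) ∩ halfBall n).indicator
          (fun _ => (b i : ℝ) • t) x := by
  set L := (Submodule.span ℝ {t} : Set (E n)) ∩ halfBall n with hL
  have hLm : MeasurableSet L := (measurableSet_span t).inter measurableSet_ball
  set U := halfBall n \ Metric.closedBall (0 : E n) r with hU
  have hUm : MeasurableSet U := measurableSet_ball.diff Metric.isClosed_closedBall.measurableSet
  have hγ := h.rectifiable.1
  have : IsFiniteMeasure ((μH[1] : Measure (E n)).restrict L) :=
    ⟨by rw [Measure.restrict_apply_univ, hausdorffMeasure_line_inter_halfBall ht]; simp⟩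
  -- `withDensityᵥ` is zero by default for a non-integrable density, so both densities must be
  -- integrable before the measures can be read as integrals.
  have hint1 : Integrable (fun x (k : Fin m) (j : Fin n) => (θ x k : ℝ) * τ x j)
      ((μH[1]).restrict γ) :=
    Integrable.of_eval fun k => Integrable.of_eval fun j =>
      (EuclideanSpace.proj j : E n →L[ℝ] ℝ).integrable_comp
        (h.integrable_smul (h.integrable_coord k))
  have hint2 : Integrable (fun (_ : E n) (k : Fin m) (j : Fin n) => (b k : ℝ) * t j)
      ((μH[1]).restrict L) := integrable_const _
  have key := Integrable.ae_eq_of_forall_setIntegral_eq (μ := (μH[1]).restrict U) _ _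
    (IntegrableOn.integrable_indicator₀ hint1 hγ).restrict
    (IntegrableOn.integrable_indicator hint2 hLm).restrict
    (fun s hs _ => by
      rw [Measure.restrict_restrict hs, setIntegral_indicator_eq hγ (hs.inter hUm),
        setIntegral_indicator_eq hLm.nullMeasurableSet (hs.inter hUm)]
      have := hr (s ∩ U) (hs.inter hUm) inter_subset_right
      unfold lineMeasure at this
      rwa [withDensityᵥ_apply hint1 (hs.inter hUm),
        withDensityᵥ_apply hint2 (hs.inter hUm)] at this)
  rw [Filter.EventuallyEq, ae_restrict_iff' hUm] at key
  filter_upwards [key] with x hx hxr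
  by_cases hxB : x ∈ halfBall n
  · have h1 := hx ⟨hxB, hxr⟩
    ext j
    have h2 := congrFun (congrFun h1 i) j
    convert h2 using 1
    · by_cases hxγ : x ∈ γ <;> simp [hxγ]
    · by_cases hxL : x ∈ L <;> simp [hxL]
  · rw [indicator_of_notMem fun hx => hxB (h.subset hx), indicator_of_notMem fun hx => hxB hx.2]

/-- The total mass of an admissible measure in the cell problem is `b ⊗ t`. -/
theorem IsDivFreeLine.setIntegral_smul_tangent {γ : Set (E n)} {θ : E n → Fin m → ℤ}
    {τ : E n → E n} (h : IsDivFreeLine (halfBall n) γ θ τ) {b : Fin m → ℤ} {t : E n}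
    (ht : ‖t‖ = 1) (hb : HasLineBoundaryValues b t γ θ τ) (i : Fin m) :
    ∫ x in γ, (θ x i : ℝ) • τ x ∂(μH[1]) = (b i : ℝ) • t := by
  obtain ⟨r, hr0, hr1, hr⟩ := hb
  have hae := h.ae_eq_line ht hr i
  set L := (Submodule.span ℝ {t} : Set (E n)) ∩ halfBall n with hL
  have hLm : MeasurableSet L := (measurableSet_span t).inter measurableSet_ball
  have hγ := h.rectifiable.1
  have : IsFiniteMeasure ((μH[1] : Measure (E n)).restrict L) :=
    ⟨by rw [Measure.restrict_apply_univ, hausdorffMeasure_line_inter_halfBall ht]; simp⟩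
  set f := γ.indicator (fun x => (θ x i : ℝ) • τ x) with hf
  set g := L.indicator (fun _ => (b i : ℝ) • t) with hg
  have hfi : Integrable f (μH[1]) :=
    IntegrableOn.integrable_indicator₀ (h.integrable_smul (h.integrable_coord i)) hγ
  have hgi : Integrable g (μH[1]) :=
    IntegrableOn.integrable_indicator (integrable_const _) hLm
  have hgint : ∫ x, g x ∂(μH[1]) = (b i : ℝ) • t := by
    rw [hg, integral_indicator hLm, setIntegral_const, measureReal_def,
      hausdorffMeasure_line_inter_halfBall ht, ENNReal.toReal_one, one_smul]
  -- It remains to show that f − g, which vanishes a.e. outside the closed ball of radius r, has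
  -- zero integral; each component is tested with a cut-off coordinate.
  rw [← integral_indicator₀ hγ, ← hf, ← hgint, ← sub_eq_zero, ← integral_sub hfi hgi]
  ext j
  obtain ⟨φ, hφ, hφc, hφs, hφj⟩ := exists_cutoff_coordinate hr0 hr1 j
  have hfφ : ∫ x, fderiv ℝ φ x (f x) ∂(μH[1]) = 0 := by
    rw [← h.divFree φ hφ hφc hφs i, ← integral_indicator₀ hγ]
    congr 1 with x
    by_cases hx : x ∈ γ <;> simp [hf, hx]
  have hgφ : ∫ x, fderiv ℝ φ x (g x) ∂(μH[1]) = 0 := by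
    -- The segment can be prolonged to the whole line, since the derivative of φ vanishes outside
    -- the half ball.
    have h1 : (fun x => fderiv ℝ φ x (g x)) =
        (Submodule.span ℝ {t} : Set (E n)).indicator
          (fun x => (b i : ℝ) * fderiv ℝ φ x t) := by
      ext x
      by_cases hxt : x ∈ (Submodule.span ℝ {t} : Set (E n))
      · rw [indicator_of_mem hxt]
        by_cases hxB : x ∈ halfBall n
        · rw [hg, indicator_of_mem (show x ∈ L from ⟨hxt, hxB⟩), map_smul, smul_eq_mul]
        · have : fderiv ℝ φ x = 0 :=
            image_eq_zero_of_notMem_tsupport fun hx => hxB (hφs (tsupport_fderiv_subset ℝ hx))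
          simp [this]
      · rw [indicator_of_notMem hxt, hg, indicator_of_notMem fun hx => hxt hx.1, map_zero]
    rw [h1, integral_indicator (measurableSet_span t), integral_const_mul,
      setIntegral_span_fderiv ht hφ hφc, mul_zero]
  have hj : (∫ x, (f x - g x) ∂(μH[1])) j = ∫ x, (f x - g x) j ∂(μH[1]) :=
    ((EuclideanSpace.proj j : E n →L[ℝ] ℝ).integral_comp_comm
      (hfi.sub hgi)).symm
  rw [hj, PiLp.zero_apply]
  calc ∫ x, (f x - g x) j ∂(μH[1])
      = ∫ x, (fderiv ℝ φ x (f x) - fderiv ℝ φ x (g x)) ∂(μH[1]) := by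
        refine integral_congr_ae ?_
        filter_upwards [hae] with x hx
        rw [← map_sub]
        by_cases hxr : x ∈ Metric.closedBall 0 r
        · rw [hφj x hxr]
        · rw [hx hxr, sub_self, map_zero]; rfl
    _ = 0 := by
        rw [integral_sub (integrable_fderiv_apply hφ hφc hfi) (integrable_fderiv_apply hφ hφc hgi),
          hfφ, hgφ, sub_zero]

/-! ### The lower bound -/

theorem decomposition_constraint_iff {A : Finset (Fin m → ℤ)} {T : (Fin m → ℤ) → E n}
    {b : Fin m → ℤ} {t : E n} :
    (∑ α ∈ A, Matrix.vecMulVec (fun i => (α i : ℝ)) (fun j => T α j)) =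
        Matrix.vecMulVec (fun i => (b i : ℝ)) (fun j => t j) ↔
      ∀ i, ∑ α ∈ A, (α i : ℝ) • T α = (b i : ℝ) • t := by
  rw [← Matrix.ext_iff]
  refine forall_congr' fun i => ?_
  rw [PiLp.ext_iff]
  refine forall_congr' fun j => ?_
  simp [Matrix.sum_apply, Matrix.vecMulVec_apply]

/-- Integrability gives measurability of the real-valued coordinates only; taking the floor recovers
the integers. -/
theorem IsDivFreeLine.aemeasurable {Ω γ : Set (E n)} {θ : E n → Fin m → ℤ} {τ : E n → E n}
    (h : IsDivFreeLine Ω γ θ τ) : AEMeasurable θ ((μH[1]).restrict γ) := by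
  refine aemeasurable_pi_iff.mpr fun i => ?_
  have := Int.measurable_floor.comp_aemeasurable (h.integrable_coord i).aemeasurable
  simpa [Function.comp_def] using this

/-- Regrouping the lines of an admissible measure of finite energy according to decompositions of
their multiplicities yields a competitor for the minimum problem. -/
theorem IsDivFreeLine.exists_decompositionValue_le {γ : Set (E n)} {θ : E n → Fin n → ℤ}
    {τ : E n → E n} (h : IsDivFreeLine (halfBall n) γ θ τ) {b : Fin n → ℤ} {t : E n}
    (ht : ‖t‖ = 1) (hb : HasLineBoundaryValues b t γ θ τ) {η : ℝ} (hη : η ∈ Icc (0 : ℝ) 1)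
    {A : Finset (Fin n → ℤ)} {c : (Fin n → ℤ) → (Fin n → ℤ) → ℕ} (hc0 : ∀ a, c a 0 = 0)
    (hc : ∀ a i, ∑ β ∈ A, (c a β : ℝ) * (β i : ℝ) = a i)
    (hcψ : ∀ a, ∀ s : E n, ‖s‖ = 1 →
      ∑ β ∈ A, (c a β : ℝ) * cubicDensity η β s ≤ cubicDensity η a s)
    (hfin : ∫⁻ x in γ, ENNReal.ofReal (cubicDensity η (θ x) (τ x)) ∂(μH[1]) ≠ ⊤) :
    ∃ e ∈ decompositionValues (cubicDensity η) A b t,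
      ENNReal.ofReal e ≤ ∫⁻ x in γ, ENNReal.ofReal (cubicDensity η (θ x) (τ x)) ∂(μH[1]) := by
  set μ := (μH[1] : Measure (E n)).restrict γ with hμ
  have hτ := h.norm_tangent
  have hψ0 : ∀ β : Fin n → ℤ, ∀ s : E n, 0 ≤ cubicDensity η β s := cubicDensity_nonneg hη.1
  have hψm : AEStronglyMeasurable (fun x => cubicDensity η (θ x) (τ x)) μ :=
    (h.integrable.aestronglyMeasurable.norm.pow 2).add
      (((h.integrable.aestronglyMeasurable.inner h.tangent.1).pow 2).const_mul η)
  have hψi : Integrable (fun x => cubicDensity η (θ x) (τ x)) μ := by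
    refine ⟨hψm, ?_⟩
    rw [hasFiniteIntegral_iff_ofReal (Filter.Eventually.of_forall fun x => hψ0 _ _)]
    exact hfin.lt_top
  have hcm : ∀ β, AEStronglyMeasurable (fun x => (c (θ x) β : ℝ)) μ := fun β =>
    ((measurable_of_countable fun a => (c a β : ℝ)).comp_aemeasurable
      h.aemeasurable).aestronglyMeasurable
  have hβm : ∀ β : Fin n → ℤ, AEStronglyMeasurable (fun x => cubicDensity η β (τ x)) μ :=
    fun β => aestronglyMeasurable_const.add
      (((aestronglyMeasurable_const.inner h.tangent.1).pow 2).const_mul η)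
  have hcψi : ∀ β ∈ A, Integrable (fun x => (c (θ x) β : ℝ) * cubicDensity η β (τ x)) μ := by
    intro β hβ
    refine hψi.mono' ((hcm β).mul (hβm β)) ?_
    filter_upwards [hτ] with x hx
    rw [Real.norm_of_nonneg (mul_nonneg (Nat.cast_nonneg _) (hψ0 _ _))]
    exact (Finset.single_le_sum (f := fun β => (c (θ x) β : ℝ) * cubicDensity η β (τ x))
      (fun β _ => mul_nonneg (Nat.cast_nonneg _) (hψ0 _ _)) hβ).trans (hcψ _ _ hx)
  -- Finite energy controls the coefficients because ψ(β,·) ≥ 1 for β ≠ 0; for β = 0 the coefficient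
  -- vanishes.
  have hci : ∀ β ∈ A, Integrable (fun x => (c (θ x) β : ℝ)) μ := by
    intro β hβ
    rcases eq_or_ne β 0 with rfl | hβ0
    · simp [hc0]
    · refine (hcψi β hβ).mono' (hcm β) (Filter.Eventually.of_forall fun x => ?_)
      rw [Real.norm_of_nonneg (Nat.cast_nonneg _)]
      exact le_mul_of_one_le_right (Nat.cast_nonneg _) (one_le_cubicDensity hη.1 hβ0 _)
  have hvi : ∀ β ∈ A, Integrable (fun x => (c (θ x) β : ℝ) • τ x) μ := fun β hβ =>
    h.integrable_smul (hci β hβ)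
  refine ⟨_, ⟨fun β => ∫ x, (c (θ x) β : ℝ) • τ x ∂μ,
    decomposition_constraint_iff.mpr fun i => ?_, rfl⟩, ?_⟩
  · rw [← h.setIntegral_smul_tangent ht hb i]
    simp_rw [← integral_smul]
    rw [← integral_finsetSum _ fun β hβ =>
      show Integrable (fun x => (β i : ℝ) • (c (θ x) β : ℝ) • τ x) μ from
        (hvi β hβ).smul (β i : ℝ)]
    refine integral_congr_ae (Filter.Eventually.of_forall fun x => ?_)
    simp only
    rw [← hc (θ x) i, Finset.sum_smul]
    exact Finset.sum_congr rfl fun β _ => by rw [smul_smul, mul_comm]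
  · rw [← ofReal_integral_eq_lintegral_ofReal hψi
      (Filter.Eventually.of_forall fun x => hψ0 _ _)]
    refine ENNReal.ofReal_le_ofReal ?_
    calc ∑ β ∈ A, homExt (cubicDensity η) β (∫ x, (c (θ x) β : ℝ) • τ x ∂μ)
        ≤ ∑ β ∈ A, ∫ x, (c (θ x) β : ℝ) * cubicDensity η β (τ x) ∂μ :=
          Finset.sum_le_sum fun β hβ => homExt_integral_le hη β
            (Filter.Eventually.of_forall fun x => Nat.cast_nonneg _) hτ (hvi β hβ) (hcψi β hβ)
      _ = ∫ x, ∑ β ∈ A, (c (θ x) β : ℝ) * cubicDensity η β (τ x) ∂μ :=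
          (integral_finsetSum _ hcψi).symm
      _ ≤ ∫ x, cubicDensity η (θ x) (τ x) ∂μ :=
          integral_mono_ae (integrable_finsetSum _ hcψi) hψi (hτ.mono fun x hx => hcψ _ _ hx)

/-! ### Existence of a minimizer -/

/-- Direct method: ψ̃(α,T) ≥ ‖T‖ for α ≠ 0 bounds sublevel sets. The vector α = 0 has no cost and no
effect on the constraint, so its T may be set to 0. -/
theorem exists_isLeast_decompositionValues {η : ℝ} (hη : 0 ≤ η) {A : Finset (Fin n → ℤ)}
    {b : Fin n → ℤ} {t : E n} (hne : (decompositionValues (cubicDensity η) A b t).Nonempty) :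
    ∃ v, IsLeast (decompositionValues (cubicDensity η) A b t) v := by
  obtain ⟨e₀, T₀, hT₀, he₀⟩ := hne
  rw [decomposition_constraint_iff] at hT₀
  -- Only the finitely many T_α with α ∈ A matter; indexing by A gives a finite-dimensional space,
  -- where closed bounded sets are compact.
  let F : (A → E n) → ℝ := fun S => ∑ α : A, homExt (cubicDensity η) α.1 (S α)
  have hF : Continuous F := continuous_finsetSum _ fun α _ =>
    (continuous_homExt hη α.1).comp (continuous_apply α)
  let K : Set (A → E n) := {S | (∀ i, ∑ α : A, (α.1 i : ℝ) • S α = (b i : ℝ) • t) ∧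
    (∀ α : A, α.1 = 0 → S α = 0) ∧ F S ≤ e₀}
  have hKc : IsCompact K := by
    refine Metric.isCompact_of_isClosed_isBounded ?_ ?_
    · have hK : K = (⋂ i, {S | ∑ α : A, (α.1 i : ℝ) • S α = (b i : ℝ) • t}) ∩
          ((⋂ α : A, ⋂ _ : α.1 = 0, {S | S α = 0}) ∩ {S | F S ≤ e₀}) := by
        ext S
        simp only [K, mem_ofPred_eq, mem_inter_iff, mem_iInter]
      rw [hK]
      exact (isClosed_iInter fun i => isClosed_eq (by fun_prop) continuous_const).inter
        ((isClosed_iInter fun α => isClosed_iInter fun _ =>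
          isClosed_eq (continuous_apply α) continuous_const).inter
          (isClosed_le hF continuous_const))
    · refine (Metric.isBounded_closedBall (x := (0 : A → E n)) (r := max e₀ 0)).subset ?_
      rintro S ⟨-, h0, hS⟩
      rw [mem_closedBall_zero_iff, pi_norm_le_iff_of_nonneg (le_max_right _ _)]
      intro α
      by_cases hα : α.1 = 0
      · rw [h0 α hα, norm_zero]; exact le_max_right _ _
      · exact (norm_le_homExt hη hα _).trans ((Finset.single_le_sum
          (f := fun α : A => homExt (cubicDensity η) α.1 (S α))
          (fun α _ => homExt_nonneg hη _ _) (Finset.mem_univ α)).trans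
          (hS.trans (le_max_left _ _)))
  have restrict : ∀ T : (Fin n → ℤ) → E n,
      (∀ i, ∑ α ∈ A, (α i : ℝ) • T α = (b i : ℝ) • t) →
      ∑ α ∈ A, homExt (cubicDensity η) α (T α) ≤ e₀ →
      ∃ S ∈ K, F S = ∑ α ∈ A, homExt (cubicDensity η) α (T α) := by
    intro T hT hTe
    have hFS : F (fun α => if α.1 = 0 then 0 else T α.1) =
        ∑ α ∈ A, homExt (cubicDensity η) α (T α) := by
      rw [← Finset.sum_coe_sort A]
      refine Finset.sum_congr rfl fun α _ => ?_
      by_cases hα : α.1 = 0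
      · rw [hα, homExt_zero_left, homExt_zero_left]
      · simp [hα]
    refine ⟨fun α => if α.1 = 0 then 0 else T α.1, ⟨fun i => ?_, fun α hα => by simp [hα],
      hFS.trans_le hTe⟩, hFS⟩
    rw [← hT i, ← Finset.sum_coe_sort A]
    refine Finset.sum_congr rfl fun α _ => ?_
    by_cases hα : α.1 = 0 <;> simp [hα]
  obtain ⟨S₀, hS₀, -⟩ := restrict T₀ hT₀ he₀.symm.le
  obtain ⟨S, hS, hmin⟩ := hKc.exists_isMinOn ⟨S₀, hS₀⟩ hF.continuousOn
  refine ⟨F S, ⟨fun α => if hα : α ∈ A then S ⟨α, hα⟩ else 0,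
    decomposition_constraint_iff.mpr fun i => ?_, ?_⟩, ?_⟩
  · rw [← hS.1 i, ← Finset.sum_coe_sort A]
    exact Finset.sum_congr rfl fun α _ => by simp
  · rw [← Finset.sum_coe_sort A]
    exact Finset.sum_congr rfl fun α _ => by simp
  · rintro e ⟨T, hT, rfl⟩
    rw [decomposition_constraint_iff] at hT
    -- Competitors costing more than the reference value e₀ lie outside K, but the minimizer costs
    -- at most e₀.
    rcases le_total (∑ α ∈ A, homExt (cubicDensity η) α (T α)) e₀ with hle | hle
    · obtain ⟨S', hS', hFS'⟩ := restrict T hT hle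
      exact (hmin hS').trans_eq hFS'
    · exact hS.2.2.trans hle

/-- If every lattice vector outside `A` splits into two smaller ones at a small angle, then the
minimum over decompositions along `A` is attained and bounds the elliptic envelope from below. -/
theorem exists_isLeast_le_ellipticEnvelope {η : ℝ} (hη : η ∈ Icc (0 : ℝ) 1)
    {A : Finset (Fin n → ℤ)}
    (hA : ∀ a ∉ A, ∃ b c : Fin n → ℤ, b + c = a ∧ latticeSize b < latticeSize a ∧
      latticeSize c < latticeSize a ∧
      ‖latticeVec b‖ * ‖latticeVec c‖ ≤ 3 * inner ℝ (latticeVec b) (latticeVec c))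
    (b : Fin n → ℤ) {t : E n} (ht : ‖t‖ = 1) :
    ∃ v : ℝ, IsLeast (decompositionValues (cubicDensity η) A b t) v ∧
      ENNReal.ofReal v ≤ ellipticEnvelope (cubicDensity η) b t := by
  choose c hc0 hc hcψ using exists_decomposition A hA
  have hne : (decompositionValues (cubicDensity η) A b t).Nonempty :=
    -- The decomposition of b itself, with all lines parallel to t, is a competitor.
    ⟨_, fun β => (c b β : ℝ) • t, decomposition_constraint_iff.mpr fun i => by
      simp_rw [smul_smul, ← Finset.sum_smul]
      rw [← hc b i]
      simp_rw [mul_comm], rfl⟩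
  obtain ⟨v, hv⟩ := exists_isLeast_decompositionValues hη.1 hne
  refine ⟨v, hv, le_sInf ?_⟩
  rintro _ ⟨γ, θ, τ, h, hb, rfl⟩
  by_cases hfin : ∫⁻ x in γ, ENNReal.ofReal (cubicDensity η (θ x) (τ x)) ∂(μH[1]) = ⊤
  · rw [hfin]; exact le_top
  · obtain ⟨e, he, hle⟩ := h.exists_decompositionValue_le ht hb hη hc0 hc
      (fun a s hs => hcψ a η hη s hs) hfin
    exact (ENNReal.ofReal_le_ofReal (hv.2 he)).trans hle

end DislocationRelaxation

theorem proposition4p1 (n : ℕ) (η : ℝ) (hη : η ∈ Set.Icc (0 : ℝ) 1)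
    (b : Fin n → ℤ) (t : DislocationRelaxation.E n) (ht : ‖t‖ = 1) :
    (n ≤ 9 → ∃ v : ℝ,
      IsLeast (DislocationRelaxation.decompositionValues
        (DislocationRelaxation.cubicDensity η)
        (Fintype.piFinset fun _ : Fin n => ({-1, 0, 1} : Finset ℤ)) b t) v ∧
      ENNReal.ofReal v ≤ DislocationRelaxation.ellipticEnvelope
        (DislocationRelaxation.cubicDensity η) b t) ∧
    (10 ≤ n → ∃ v : ℝ,
      IsLeast (DislocationRelaxation.decompositionValues
        (DislocationRelaxation.cubicDensity η)
        (Fintype.piFinset fun _ : Fin n => Finset.Icc (-(2 * n : ℤ)) (2 * n)) b t) v ∧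
      ENNReal.ofReal v ≤ DislocationRelaxation.ellipticEnvelope
        (DislocationRelaxation.cubicDensity η) b t) := by
  open DislocationRelaxation in
  exact ⟨fun hn => exists_isLeast_le_ellipticEnvelope hη (exists_split_sign hn) b ht,
    fun hn => exists_isLeast_le_ellipticEnvelope hη
      (exists_split_half (le_trans (by norm_num) hn)) b ht⟩
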